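/- Let $G$ be a finitely generated free group with at least two (free) generators, let $E$ be a Euclidean space (a finite-dimensional real inner product space) with $\dim E \ge 1$, and let $\Phi\colon G\times E\to E$ be a linear action of $G$ on $E$: writing $f_g=\Phi(g,\cdot)$, every $f_g$ is a linear homeomorphism of $E$, $f_e=\mathrm{id}$, and $f_{g_1g_2}=f_{g_1}\circ f_{g_2}$ for all $g_1,g_2\in G$. Then $\Phi$ is uniformly continuous, that is, for some generating set $T=T^{-1}$ of $G$ all the maps $f_s$, $s\in T$, are uniformly continuous; and $\Phi$ does not have the shadowing property with respect to any finite symmetric generating set $S=S^{-1}$ of $G$. Here $\Phi$ has the shadowing property with respect to $S$ if for every $\varepsilon>0$ there is $d>0$ such that for every family $\{y_g\}_{g\in G}$ in $E$ with $\operatorname{dist}(y_{sg},f_s(y_g))<d$ for all $s\in S$, $g\in G$, there is a point $x_e\in E$ with $\operatorname{dist}(y_g,f_g(x_e))<\varepsilon$ for all $g\in G$. -/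

import Mathlib

namespace Shadowing

/-- A (left) action of the group `G` on the metric space `Ω`: a map `Φ : G × Ω → Ω` (written in
curried form, `Φ g` being the map `f_g`) such that every `f_g` is a homeomorphism of `Ω`,
`f_e = id`, and `f_{g₁ g₂} = f_{g₁} ∘ f_{g₂}`. -/
structure IsAction {G Ω : Type*} [Group G] [MetricSpace Ω] (Φ : G → Ω → Ω) : Prop where
  isHomeomorph : ∀ g : G, IsHomeomorph (Φ g)
  one_apply : ∀ x : Ω, Φ 1 x = x
  mul_apply : ∀ (g₁ g₂ : G) (x : Ω), Φ (g₁ * g₂) x = Φ g₁ (Φ g₂ x)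

/-- `S` is a symmetric generating set of the group `G`: it generates `G` and contains the inverse
of each of its elements. -/
structure IsSymmGenSet {G : Type*} [Group G] (S : Set G) : Prop where
  inv_mem : ∀ s ∈ S, s⁻¹ ∈ S
  closure_eq_top : Subgroup.closure S = ⊤

/-- An action is uniformly continuous if, for some symmetric generating set `S` of the group,
the maps `f_s`, `s ∈ S`, are uniformly continuous. -/
def IsUniformlyContinuous {G Ω : Type*} [Group G] [MetricSpace Ω] (Φ : G → Ω → Ω) : Prop :=
  ∃ S : Set G, IsSymmGenSet S ∧ ∀ s ∈ S, UniformContinuous (Φ s)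

/-- `y` is a `d`-pseudotrajectory of `Φ` with respect to `S`:
`dist (y_{sg}, f_s (y_g)) < d` for all `s ∈ S` and `g ∈ G`. -/
def IsPseudotrajectory {G Ω : Type*} [Group G] [MetricSpace Ω] (Φ : G → Ω → Ω) (S : Set G)
    (d : ℝ) (y : G → Ω) : Prop :=
  ∀ s ∈ S, ∀ g : G, dist (y (s * g)) (Φ s (y g)) < d

/-- The action `Φ` has the shadowing property on `V` (with respect to the generating set `S`). -/
def HasShadowingOn {G Ω : Type*} [Group G] [MetricSpace Ω] (Φ : G → Ω → Ω) (S : Set G)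
    (V : Set Ω) : Prop :=
  ∀ ε : ℝ, 0 < ε → ∃ d : ℝ, 0 < d ∧
    ∀ y : G → Ω, (∀ g : G, y g ∈ V) → IsPseudotrajectory Φ S d y →
      ∃ x : Ω, ∀ g : G, dist (y g) (Φ g x) < ε

/-- The action `Φ` has the shadowing property (with respect to the generating set `S`). -/
def HasShadowing {G Ω : Type*} [Group G] [MetricSpace Ω] (Φ : G → Ω → Ω) (S : Set G) : Prop :=
  HasShadowingOn Φ S Set.univ

end Shadowing

/-!
Write `ρ g` for the linear map `Φ g`. In the coordinates `z g = ρ g⁻¹ (y g)` exact trajectories are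
constant functions, and linearity removes the quantifiers over `ε` and `d`: the shadowing property
implies that whenever `‖ρ (s * g) (z (s * g) - z g)‖` is bounded over `s ∈ S` and `g`, some
`x` makes `‖ρ g (z g - x)‖` bounded over `g` (`BoundedShadowing`).

For a set `A` of group elements consider the subspace `boundedOn ρ A` of vectors `x` for which
`‖ρ h⁻¹ x‖` is bounded over `h ∈ A`. If every right translation changes `A` by finitely many
elements only, the function equal to `w` on `A⁻¹` and to `0` elsewhere has bounded defects, and
shadowing it gives `boundedOn ρ A ⊔ boundedOn ρ Aᶜ = ⊤`. This applies to the set of reduced words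
of a free group starting with a letter `t`. Let `P t` and `W t` be the two subspaces obtained.
Left translation by `t⁻¹` carries words not starting with `t` to words starting with `t⁻¹`, so
`dim P t⁻¹ ≤ dim W t`, while `W t ≤ P u` for all letters `u ≠ t`. Taking `u = t⁻¹` shows
`W t = P t⁻¹`, and then `P t⁻¹ ≤ P u` for all `u ≠ t`. With at least two generators this forces
all `P t` to coincide, hence to be the whole space.

So all orbits are bounded, and by Banach-Steinhaus the maps `ρ g` are uniformly bounded. Then
`z g = n g • v`, with `n` the exponent sum and `v ≠ 0`, has bounded defects, but cannot stay at
bounded distance from a constant, because `n` is unbounded.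
-/

namespace Shadowing

open FreeGroup

/-! ### Shadowing for linear actions -/

section BoundedShadowing

variable {G E : Type*} [Group G] [NormedAddCommGroup E] [NormedSpace ℝ E]

/-- The scale-free form of the shadowing property for a linear action, expressed through
`z g = ρ g⁻¹ (y g)`: if the one-step errors `ρ (s * g) (z (s * g) - z g)` of `z` are bounded, then
`z` stays at bounded distance, measured along the action, from a constant. -/
def BoundedShadowing (ρ : Representation ℝ G E) (S : Set G) : Prop :=
  ∀ z : G → E, (∃ C : ℝ, ∀ s ∈ S, ∀ g : G, ‖ρ (s * g) (z (s * g) - z g)‖ ≤ C) →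
    ∃ (x : E) (K : ℝ), ∀ g : G, ‖ρ g (z g - x)‖ ≤ K

theorem HasShadowing.boundedShadowing {Φ : G → E → E} {S : Set G} (h : HasShadowing Φ S)
    (ρ : Representation ℝ G E) (hρ : ∀ g x, ρ g x = Φ g x) : BoundedShadowing ρ S := by
  rintro z ⟨C, hC⟩
  obtain ⟨d, hd, H⟩ := h 1 one_pos
  -- A nonzero multiple `c • z` has one-step errors below `d`.
  obtain ⟨c, hc, hcd⟩ : ∃ c : ℝ, 0 < c ∧ c * C < d := by
    refine ⟨d / (|C| + 1), by positivity, ?_⟩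
    rw [div_mul_eq_mul_div, div_lt_iff₀ (by positivity)]
    nlinarith [le_abs_self C]
  obtain ⟨x, hx⟩ := H (fun g => ρ g (c • z g)) (fun _ => trivial) (by
    intro s hs g
    have e : ρ (s * g) (c • z (s * g)) - Φ s (ρ g (c • z g))
        = c • ρ (s * g) (z (s * g) - z g) := by
      rw [← hρ, ← Module.End.mul_apply, ← map_mul ρ, ← map_sub, ← smul_sub, map_smul]
    rw [dist_eq_norm, e, norm_smul, Real.norm_of_nonneg hc.le]
    exact (mul_le_mul_of_nonneg_left (hC s hs g) hc.le).trans_lt hcd)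
  refine ⟨c⁻¹ • x, c⁻¹, fun g => ?_⟩
  have e : ρ g (z g - c⁻¹ • x) = c⁻¹ • (ρ g (c • z g) - Φ g x) := by
    rw [← hρ, ← map_sub, ← map_smul, smul_sub, inv_smul_smul₀ hc.ne']
  rw [e, norm_smul, Real.norm_of_nonneg (inv_pos.2 hc).le]
  have := (hx g).le
  rw [dist_eq_norm] at this
  exact mul_le_of_le_one_right (inv_pos.2 hc).le this

theorem BoundedShadowing.comp_equiv {H : Type*} [Group H] {ρ : Representation ℝ G E} {S : Set G}
    (h : BoundedShadowing ρ S) (e : H ≃* G) :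
    BoundedShadowing (ρ.comp e.toMonoidHom : Representation ℝ H E) (e ⁻¹' S) := by
  rintro z ⟨C, hC⟩
  obtain ⟨x, K, hx⟩ := h (fun g => z (e.symm g)) ⟨C, fun s hs g => by
    simpa using hC (e.symm s) (by simpa using hs) (e.symm g)⟩
  exact ⟨x, K, fun g => by simpa using hx (e g)⟩

/-- The subspace of vectors whose orbit is bounded along the inverses of the elements of `A`. -/
def boundedOn (ρ : Representation ℝ G E) (A : Set G) : Submodule ℝ E where
  carrier := {x | ∃ K : ℝ, ∀ h ∈ A, ‖ρ h⁻¹ x‖ ≤ K}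
  zero_mem' := ⟨0, by simp⟩
  add_mem' := by
    rintro x y ⟨K, hK⟩ ⟨L, hL⟩
    refine ⟨K + L, fun h hh => ?_⟩
    rw [map_add]
    exact (norm_add_le _ _).trans (add_le_add (hK h hh) (hL h hh))
  smul_mem' := by
    rintro c x ⟨K, hK⟩
    refine ⟨‖c‖ * K, fun h hh => ?_⟩
    rw [map_smul, norm_smul]
    exact mul_le_mul_of_nonneg_left (hK h hh) (norm_nonneg c)

theorem boundedOn_anti (ρ : Representation ℝ G E) {A B : Set G} (h : A ⊆ B) :
    boundedOn ρ B ≤ boundedOn ρ A := fun _ ⟨K, hK⟩ => ⟨K, fun g hg => hK g (h hg)⟩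

/-- A set that each right translation changes by finitely many elements only splits the space:
shadow the function that jumps from `0` to a given vector across the boundary of the set. -/
theorem BoundedShadowing.boundedOn_sup_compl {ρ : Representation ℝ G E} {S : Set G}
    (h : BoundedShadowing ρ S) (hS : S.Finite) {A : Set G}
    (hA : ∀ s, {k | ¬ (k * s ∈ A ↔ k ∈ A)}.Finite) :
    boundedOn ρ A ⊔ boundedOn ρ Aᶜ = ⊤ := by
  classical
  refine eq_top_iff.2 fun w _ => ?_
  let z : G → E := fun g => if g⁻¹ ∈ A then w else 0
  -- Off a finite set of pairs `(s, g)` the one-step error vanishes.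
  have hfin : (⋃ s ∈ S, (fun k : G => ‖ρ (s * k⁻¹) (z (s * k⁻¹) - z k⁻¹)‖) ''
      {k | ¬ (k * s⁻¹ ∈ A ↔ k ∈ A)}).Finite :=
    hS.biUnion fun s _ => (hA s⁻¹).image _
  obtain ⟨C, hC⟩ := hfin.bddAbove
  obtain ⟨x, K, hx⟩ := h z ⟨max C 0, fun s hs g => by
    by_cases hg : g⁻¹ * s⁻¹ ∈ A ↔ g⁻¹ ∈ A
    · have : z (s * g) = z g := by simp [z, hg]
      simp [this]
    · refine le_max_of_le_left (hC (Set.mem_biUnion hs ⟨g⁻¹, hg, ?_⟩))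
      simp⟩
  refine Submodule.mem_sup.2 ⟨w - x, ⟨K, fun k hk => ?_⟩, x, ⟨K, fun k hk => ?_⟩, by simp⟩
  · simpa [z, hk] using hx k⁻¹
  · have hk' : k ∉ A := hk
    simpa [z, hk'] using hx k⁻¹

/-- A uniformly bounded linear action with an unbounded homomorphism to `ℤ` has no shadowing: the
multiples of a fixed vector prescribed by the homomorphism drift away from every constant. -/
theorem not_boundedShadowing_of_bounded [Nontrivial E] {ρ : Representation ℝ G E} {S : Set G}
    (hS : S.Finite) {M : ℝ} (hM : ∀ g x, ‖ρ g x‖ ≤ M * ‖x‖) (φ : G →* Multiplicative ℤ)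
    (hφ : Function.Surjective φ) : ¬ BoundedShadowing ρ S := by
  intro h
  obtain ⟨v, hv⟩ := exists_ne (0 : E)
  obtain ⟨C, hC⟩ := (hS.image fun s => M * ‖((φ s).toAdd : ℝ) • v‖).bddAbove
  obtain ⟨x, K, hx⟩ := h (fun g => ((φ g).toAdd : ℝ) • v) ⟨C, fun s hs g => by
    have e : ((φ (s * g)).toAdd : ℝ) • v - ((φ g).toAdd : ℝ) • v = ((φ s).toAdd : ℝ) • v := by
      rw [← sub_smul]; simp
    rw [e]
    exact (hM _ _).trans (hC ⟨s, hs, rfl⟩)⟩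
  have hM0 : 0 ≤ M := nonneg_of_mul_nonneg_left
    ((norm_nonneg _).trans (hM 1 v)) (norm_pos_iff.2 hv)
  have key : ∀ n : ℕ, (n : ℝ) * ‖v‖ ≤ M * K + ‖x‖ := by
    intro n
    obtain ⟨g, hg⟩ := hφ (Multiplicative.ofAdd (n : ℤ))
    have h1 : ‖(n : ℝ) • v - x‖ ≤ M * K := by
      have h2 := hx g
      have h3 := hM g⁻¹ (ρ g ((n : ℝ) • v - x))
      rw [Representation.inv_self_apply] at h3
      simp only [hg, toAdd_ofAdd, Int.cast_natCast] at h2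
      exact h3.trans (mul_le_mul_of_nonneg_left h2 hM0)
    have h4 := norm_sub_norm_le ((n : ℝ) • v) x
    rw [norm_smul, Real.norm_natCast] at h4
    linarith
  obtain ⟨n, hn⟩ := exists_nat_gt ((M * K + ‖x‖) / ‖v‖)
  rw [div_lt_iff₀ (norm_pos_iff.2 hv)] at hn
  exact absurd (key n) (not_le.2 hn)

end BoundedShadowing

/-! ### Words starting with a given letter -/

section FreeGroup

variable {ι : Type*} [DecidableEq ι]

/-- Appending one letter can change the first letter of a reduced word only if the word has
length at most one. -/
theorem mul_mk_mem_startsWith {t s : ι × Bool} {g : FreeGroup ι} (hg : g ∈ startsWith t)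
    (hn : 1 < g.norm) : g * mk [s] ∈ startsWith t := by
  have hr : IsReduced g.toWord := isReduced_toWord
  rcases List.eq_nil_or_concat' g.toWord with h | ⟨L, r, h⟩
  · simp [FreeGroup.norm, h] at hn
  have hL : L ≠ [] := by rintro rfl; simp [FreeGroup.norm, h] at hn
  obtain ⟨a, L, rfl⟩ := List.exists_cons_of_ne_nil hL
  have ha : a = t := by simpa [startsWith, h] using hg
  subst ha
  rw [h] at hr
  have hg' : g * mk [s] = mk (a :: L ++ [r] ++ [s]) := by
    rw [← mul_mk, ← h, mk_toWord]
  by_cases hrs : r.1 = s.1 → r.2 = s.2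
  · have : IsReduced (a :: L ++ [r] ++ [s]) :=
      hr.append_overlap (by simpa [FreeGroup.IsReduced] using hrs) (by simp)
    rw [hg', startsWith, Set.mem_ofPred_eq, toWord_mk, this.reduce_eq]
    rfl
  · have hs : s = (r.1, !r.2) := by
      obtain ⟨h1, h2⟩ := Classical.not_imp.1 hrs
      exact Prod.ext h1.symm (by cases hr2 : r.2 <;> cases hs2 : s.2 <;> simp_all)
    have : g * mk [s] = mk (a :: L) := by
      have e : mk [r] * mk [s] = (1 : FreeGroup ι) := by
        rw [hs, ← mul_inv_cancel (mk [r]), inv_mk]; rfl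
      rw [hg', ← mul_mk, ← mul_mk, mul_assoc, e, mul_one]
    have hr' : IsReduced (a :: L) := hr.infix ⟨[], [r], by simp⟩
    rw [this, startsWith, Set.mem_ofPred_eq, toWord_mk, hr'.reduce_eq]
    rfl

theorem finite_norm_le_one [Finite ι] : {g : FreeGroup ι | g.norm ≤ 1}.Finite :=
  (List.finite_length_le (ι × Bool) 1).preimage toWord_injective.injOn

theorem finite_mul_mem_startsWith_ne [Finite ι] (t : ι × Bool) (s : FreeGroup ι) :
    {k | ¬ (k * s ∈ startsWith t ↔ k ∈ startsWith t)}.Finite := by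
  have hs : s ∈ Subgroup.closure (Set.range (of : ι → FreeGroup ι)) := by
    rw [closure_range_of]; trivial
  induction hs using Subgroup.closure_induction with
  | mem s hs =>
    obtain ⟨i, rfl⟩ := hs
    refine (finite_norm_le_one.union
      (finite_norm_le_one.preimage (mul_left_injective (of i)).injOn)).subset fun k hk => ?_
    by_contra! hcon
    simp only [Set.mem_union, Set.mem_ofPred_eq, Set.mem_preimage, not_or, not_le] at hcon hk
    refine hk ⟨fun h => ?_, fun h => mul_mk_mem_startsWith h hcon.1⟩
    have := mul_mk_mem_startsWith (s := (i, false)) h hcon.2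
    have e : k * of i * mk [(i, false)] = k := by
      rw [show mk [(i, false)] = (of i)⁻¹ from rfl, mul_inv_cancel_right]
    rwa [e] at this
  | one => simp
  | mul a b _ _ ha hb =>
    refine (ha.union (hb.preimage (mul_left_injective a).injOn)).subset fun k hk => ?_
    simp only [Set.mem_union, Set.mem_ofPred_eq, Set.mem_preimage, ← mul_assoc] at hk ⊢
    tauto
  | inv a _ ha =>
    refine (ha.preimage (mul_left_injective a⁻¹).injOn).subset fun k hk => ?_
    simp only [Set.mem_ofPred_eq, Set.mem_preimage, inv_mul_cancel_right] at hk ⊢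
    tauto

end FreeGroup

/-! ### Linear actions of free groups -/

section Linear

variable {ι E : Type*} [DecidableEq ι] [NormedAddCommGroup E] [NormedSpace ℝ E]
  {ρ : Representation ℝ (FreeGroup ι) E} {S : Set (FreeGroup ι)}

theorem boundedOn_compl_startsWith_le (ρ : Representation ℝ (FreeGroup ι) E) {t u : ι × Bool}
    (h : u ≠ t) : boundedOn ρ (startsWith t)ᶜ ≤ boundedOn ρ (startsWith u) :=
  boundedOn_anti ρ (startsWith.disjoint_iff_ne.2 h).subset_compl_right

variable [FiniteDimensional ℝ E]

/-- The inverse letter `u = t⁻¹` maps words not starting with `t` to words starting with `u`, so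
`ρ u⁻¹` embeds the first subspace into the second. -/
theorem finrank_boundedOn_startsWith_le (ρ : Representation ℝ (FreeGroup ι) E) (t : ι × Bool) :
    Module.finrank ℝ (boundedOn ρ (startsWith (t.1, !t.2))) ≤
      Module.finrank ℝ (boundedOn ρ (startsWith t)ᶜ) := by
  set u : FreeGroup ι := mk [(t.1, !t.2)]
  have hinj : Function.Injective (ρ u⁻¹) :=
    Function.LeftInverse.injective (g := ρ u) fun x => ρ.self_inv_apply u x
  rw [(Submodule.equivMapOfInjective _ hinj _).finrank_eq]
  refine Submodule.finrank_mono ?_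
  rintro _ ⟨x, ⟨K, hK⟩, rfl⟩
  refine ⟨K, fun k hk => ?_⟩
  have := hK (u * k) (startsWith_mk_mul k (by simpa using hk))
  rwa [mul_inv_rev, map_mul ρ] at this

/-- The inclusion from right to left holds because the dimensions leave no room for a proper one. -/
theorem boundedOn_compl_startsWith (ρ : Representation ℝ (FreeGroup ι) E) (t : ι × Bool) :
    boundedOn ρ (startsWith t)ᶜ = boundedOn ρ (startsWith (t.1, !t.2)) :=
  Submodule.eq_of_le_of_finrank_le
    (boundedOn_compl_startsWith_le ρ fun h => by simpa using congrArg Prod.snd h)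
    (finrank_boundedOn_startsWith_le ρ t)

theorem boundedOn_startsWith_flip_le (ρ : Representation ℝ (FreeGroup ι) E) {t u : ι × Bool}
    (h : u ≠ t) : boundedOn ρ (startsWith (t.1, !t.2)) ≤ boundedOn ρ (startsWith u) :=
  boundedOn_compl_startsWith ρ t ▸ boundedOn_compl_startsWith_le ρ h

variable [Finite ι] [Nontrivial ι]

theorem BoundedShadowing.boundedOn_startsWith (h : BoundedShadowing ρ S) (hS : S.Finite)
    (t : ι × Bool) : boundedOn ρ (startsWith t) = ⊤ := by
  obtain ⟨j, hj⟩ := exists_ne t.1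
  -- A letter `u` with another index links the subspaces of `t⁻¹` and `t`.
  have h1 : boundedOn ρ (startsWith (t.1, !t.2)) ≤ boundedOn ρ (startsWith (j, true)) :=
    boundedOn_startsWith_flip_le ρ fun e => hj (congrArg Prod.fst e)
  have h2 : boundedOn ρ (startsWith (j, true)) ≤ boundedOn ρ (startsWith t) :=
    boundedOn_startsWith_flip_le ρ (t := (j, false)) fun e => hj (congrArg Prod.fst e).symm
  have h3 := h.boundedOn_sup_compl hS (finite_mul_mem_startsWith_ne t)
  rwa [boundedOn_compl_startsWith, sup_eq_left.2 (h1.trans h2)] at h3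

theorem BoundedShadowing.exists_bound (h : BoundedShadowing ρ S) (hS : S.Finite) :
    ∃ M : ℝ, ∀ g x, ‖ρ g x‖ ≤ M * ‖x‖ := by
  obtain ⟨i⟩ : Nonempty ι := inferInstance
  have hb : ∀ x, ∃ K, ∀ g, ‖LinearMap.toContinuousLinearMap (ρ g) x‖ ≤ K := by
    intro x
    have h1 : x ∈ boundedOn ρ (startsWith (i, true)) := by
      rw [h.boundedOn_startsWith hS]; trivial
    have h2 : x ∈ boundedOn ρ (startsWith (i, true))ᶜ := by
      rw [boundedOn_compl_startsWith, h.boundedOn_startsWith hS]; trivial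
    obtain ⟨K, hK⟩ := h1
    obtain ⟨L, hL⟩ := h2
    refine ⟨max K L, fun g => ?_⟩
    by_cases hg : g⁻¹ ∈ startsWith (i, true)
    · exact le_max_of_le_left (by simpa using hK _ hg)
    · exact le_max_of_le_right (by simpa using hL _ hg)
  have : CompleteSpace E := FiniteDimensional.complete ℝ E
  obtain ⟨M, hM⟩ := banach_steinhaus hb
  exact ⟨M, fun g x => (LinearMap.toContinuousLinearMap (ρ g)).le_of_opNorm_le (hM g) x⟩

theorem not_boundedShadowing [Nontrivial E] (ρ : Representation ℝ (FreeGroup ι) E)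
    (hS : S.Finite) : ¬ BoundedShadowing ρ S := by
  intro h
  obtain ⟨M, hM⟩ := h.exists_bound hS
  obtain ⟨i⟩ : Nonempty ι := inferInstance
  refine not_boundedShadowing_of_bounded hS hM
    (FreeGroup.lift fun _ => Multiplicative.ofAdd (1 : ℤ)) (fun n => ⟨of i ^ n.toAdd, ?_⟩) h
  rw [map_zpow, lift_apply_of, ← ofAdd_zsmul]
  simp

end Linear

end Shadowing

theorem theorem3 {ι G E : Type*} [Finite ι] [Nontrivial ι] [Group G] (b : FreeGroupBasis ι G)
    [NormedAddCommGroup E] [InnerProductSpace ℝ E] [FiniteDimensional ℝ E] [Nontrivial E]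
    (Φ : G → E → E) (hΦ : Shadowing.IsAction Φ) (hlin : ∀ g : G, IsLinearMap ℝ (Φ g)) :
    Shadowing.IsUniformlyContinuous Φ ∧
      ∀ S : Set G, S.Finite → Shadowing.IsSymmGenSet S → ¬ Shadowing.HasShadowing Φ S := by
  classical
  refine ⟨⟨Set.univ, ⟨fun _ _ => trivial, Subgroup.closure_univ⟩, fun s _ => ?_⟩, ?_⟩
  · exact (LinearMap.toContinuousLinearMap ((hlin s).mk' (Φ s))).uniformContinuous
  · intro S hS _ h
    let ρ : Representation ℝ G E :=
      { toFun := fun g => (hlin g).mk' (Φ g)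
        map_one' := LinearMap.ext hΦ.one_apply
        map_mul' := fun g₁ g₂ => LinearMap.ext (hΦ.mul_apply g₁ g₂) }
    have hb := (h.boundedShadowing ρ fun _ _ => rfl).comp_equiv b.repr.symm
    exact Shadowing.not_boundedShadowing _ (hS.preimage b.repr.symm.injective.injOn) hb
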